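/- Let $q \ge 5$ be a prime power, let $\mathbb{F}_q$ be the finite field of order $q$, and let $LG_q$ be the Levi graph of the Desarguesian projective plane $PG(2,q)$: its vertices are the $1$-dimensional subspaces (points) and the $2$-dimensional subspaces (lines) of $\mathbb{F}_q^3$, and a point $p$ is adjacent to a line $\ell$ if and only if $p \subset \ell$; there are no other edges. For a graph $G$, let the distinguishing chromatic number $\chi_D(G)$ be the least integer $r$ such that $G$ has a proper coloring with $r$ colors for which the identity is the only automorphism of $G$ that maps every color class onto itself. Then $$\chi_D(LG_q) = 3.$$ -/

import Mathlib

/-- A proper coloring `C` of `G` is distinguishing if the identity is the only automorphism of `G`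
that maps every color class onto itself. -/
def IsDistinguishing {V α : Type*} {G : SimpleGraph V} (C : G.Coloring α) : Prop :=
  ∀ φ : G ≃g G, (∀ c : α, φ '' C.colorClass c = C.colorClass c) → φ = RelIso.refl G.Adj

/-- The distinguishing chromatic number: the least number of colors in a proper distinguishing
coloring, with value `⊤` if there is no such coloring with finitely many colors. -/
noncomputable def distinguishingChromaticNumber {V : Type*} (G : SimpleGraph V) : ℕ∞ :=
  ⨅ n ∈ {n : ℕ | ∃ C : G.Coloring (Fin n), IsDistinguishing C}, (n : ℕ∞)

/-- The `k`-dimensional subspaces of `F³`: points for `k = 1`, lines for `k = 2`. -/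
abbrev SubspaceOfDim (F : Type*) [Field F] (k : ℕ) : Type _ :=
  {W : Submodule F (Fin 3 → F) // Module.finrank F W = k}

/-- The Levi graph of the Desarguesian projective plane over `F`: its vertices are the points and
the lines, and a point is adjacent to a line if and only if it lies on it. -/
def leviGraph (F : Type*) [Field F] :
    SimpleGraph (SubspaceOfDim F 1 ⊕ SubspaceOfDim F 2) where
  Adj
    | Sum.inl p, Sum.inr l => p.1 ≤ l.1
    | Sum.inr l, Sum.inl p => p.1 ≤ l.1
    | _, _ => False
  symm := ⟨by rintro (p | l) (p' | l') h <;> exact h⟩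
  loopless := ⟨by rintro (p | l) h <;> exact h⟩

/-! Lower bound: any two points lie on a common line and any two lines share a point, so at most two
colors force all points to agree and all lines to agree. Every collineation then preserves the
coloring, and swapping two coordinates is a nontrivial one.

Upper bound: take a generator `g` of the unit group and let the third color be shared by the line at
infinity and a set of affine points, the x-axis, the y-axis without `(0, g)`, and `(1, 1)`. A
color-preserving automorphism cannot exchange points and lines (`exists_map_inl_eq`), so it is a
collineation fixing the line at infinity and the special set. Counting special points on lines shows
that both axes, `(1, 1)` and `(0, g)` are fixed (`affinePoint_fixed`). Multiplication by `g` can be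
constructed by joining and intersecting, so every affine point is fixed
(`affinePoint_fixed_of_frame`). Fixing `g` also excludes field automorphisms, with no appeal to the
fundamental theorem of projective geometry. -/

namespace LeviGraph

variable {F : Type*} [Field F]

/-! ### Homogeneous coordinates and the incidence axioms -/

/-- The point with homogeneous coordinates `v`. -/
def point (v : Fin 3 → F) (hv : v ≠ 0) : SubspaceOfDim F 1 :=
  ⟨F ∙ v, finrank_span_singleton hv⟩

/-- The line with equation `w ⬝ᵥ x = 0`. -/
def line (w : Fin 3 → F) (hw : w ≠ 0) : SubspaceOfDim F 2 :=
  ⟨LinearMap.ker (dotProductEquiv F (Fin 3) w), by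
    have h := Module.Dual.finrank_ker_add_one_of_ne_zero (f := dotProductEquiv F (Fin 3) w)
      (by simpa using hw)
    simp at h
    exact h⟩

theorem point_le_line_iff {v w : Fin 3 → F} {hv : v ≠ 0} {hw : w ≠ 0} :
    (point v hv).1 ≤ (line w hw).1 ↔ w ⬝ᵥ v = 0 := by
  simp [point, line, Submodule.span_singleton_le_iff_mem]

theorem exists_eq_point (p : SubspaceOfDim F 1) : ∃ v hv, p = point v hv := by
  obtain ⟨W, hW⟩ := p
  obtain ⟨v, hv, h⟩ := finrank_eq_one_iff'.1 hW
  have hv' : (v : Fin 3 → F) ≠ 0 := by simpa using hv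
  refine ⟨v, hv', Subtype.ext ?_⟩
  symm
  refine Submodule.eq_of_le_of_finrank_eq ?_ ?_
  · simp [point, Submodule.span_singleton_le_iff_mem]
  · rw [hW, (point (v : Fin 3 → F) hv').2]

theorem exists_eq_line (l : SubspaceOfDim F 2) : ∃ w hw, l = line w hw := by
  obtain ⟨W, hW⟩ := l
  have hlt : W < ⊤ := lt_top_iff_ne_top.2 (by rintro rfl; simp at hW)
  obtain ⟨f, hf, hWf⟩ := Submodule.exists_le_ker_of_lt_top W hlt
  obtain ⟨w, rfl⟩ := (dotProductEquiv F (Fin 3)).surjective f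
  have hw : w ≠ 0 := by simpa using hf
  refine ⟨w, hw, Subtype.ext (Submodule.eq_of_le_of_finrank_eq hWf ?_)⟩
  rw [hW]
  exact (line w hw).2.symm

/-- Distinct lines meet in dimension at most 1, so a point on both equals their intersection. -/
theorem eq_of_incident {p p' : SubspaceOfDim F 1} {l l' : SubspaceOfDim F 2}
    (h1 : p.1 ≤ l.1) (h2 : p.1 ≤ l'.1) (h3 : p'.1 ≤ l.1) (h4 : p'.1 ≤ l'.1) :
    p = p' ∨ l = l' := by
  by_cases hl : l = l'
  · exact Or.inr hl
  left
  have hlt : l.1 ⊓ l'.1 < l.1 := by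
    refine lt_of_le_of_ne inf_le_left fun h => hl (Subtype.ext ?_)
    exact Submodule.eq_of_le_of_finrank_eq (inf_eq_left.1 h) (l.2.trans l'.2.symm)
  have h := Submodule.finrank_lt_finrank_of_lt hlt
  rw [l.2] at h
  have key : ∀ r : SubspaceOfDim F 1, r.1 ≤ l.1 → r.1 ≤ l'.1 → r.1 = l.1 ⊓ l'.1 :=
    fun r hr hr' => Submodule.eq_of_le_of_finrank_le (le_inf hr hr') (by rw [r.2]; omega)
  exact Subtype.ext ((key p h1 h2).trans (key p' h3 h4).symm)

theorem exists_line_through (p p' : SubspaceOfDim F 1) :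
    ∃ l : SubspaceOfDim F 2, p.1 ≤ l.1 ∧ p'.1 ≤ l.1 := by
  obtain ⟨v, hv, rfl⟩ := exists_eq_point p
  obtain ⟨v', hv', rfl⟩ := exists_eq_point p'
  -- The zero row makes the matrix singular even when the points coincide; a kernel vector gives the
  -- equation of the line.
  obtain ⟨w, hw, h⟩ := Matrix.exists_mulVec_eq_zero_iff.2
    (show (Matrix.of ![v, v', 0]).det = 0 from Matrix.det_eq_zero_of_row_eq_zero 2 (by simp))
  refine ⟨line w hw, ?_, ?_⟩ <;> rw [point_le_line_iff, dotProduct_comm]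
  · simpa [Matrix.mulVec] using congrFun h 0
  · simpa [Matrix.mulVec] using congrFun h 1

theorem exists_common_point (l l' : SubspaceOfDim F 2) :
    ∃ p : SubspaceOfDim F 1, p.1 ≤ l.1 ∧ p.1 ≤ l'.1 := by
  obtain ⟨w, hw, rfl⟩ := exists_eq_line l
  obtain ⟨w', hw', rfl⟩ := exists_eq_line l'
  obtain ⟨v, hv, h⟩ := Matrix.exists_mulVec_eq_zero_iff.2
    (show (Matrix.of ![w, w', 0]).det = 0 from Matrix.det_eq_zero_of_row_eq_zero 2 (by simp))
  refine ⟨point v hv, ?_, ?_⟩ <;> rw [point_le_line_iff]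
  · simpa [Matrix.mulVec] using congrFun h 0
  · simpa [Matrix.mulVec] using congrFun h 1

/-! ### Colorings with two colors -/

/-- The automorphism of the Levi graph induced by a linear automorphism of `F³`. -/
def autOfLinearEquiv (e : (Fin 3 → F) ≃ₗ[F] (Fin 3 → F)) : leviGraph F ≃g leviGraph F where
  toEquiv := Equiv.sumCongr
    ((Submodule.orderIsoMapComap e).toEquiv.subtypeEquiv fun W =>
      by
      rw [← e.finrank_map_eq W]; rfl)
    ((Submodule.orderIsoMapComap e).toEquiv.subtypeEquiv fun W =>
      by
      rw [← e.finrank_map_eq W]; rfl)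
  map_rel_iff' := by
    rintro (p | l) (p' | l')
    · exact Iff.rfl
    · exact (Submodule.orderIsoMapComap e).le_iff_le
    · exact (Submodule.orderIsoMapComap e).le_iff_le
    · exact Iff.rfl

theorem not_isDistinguishing_of_lt_three {n : ℕ} (hn : n < 3)
    (C : (leviGraph F).Coloring (Fin n)) : ¬ IsDistinguishing C := by
  intro hC
  have hpp : ∀ p p' : SubspaceOfDim F 1, C (Sum.inl p) = C (Sum.inl p') := fun p p' => by
    obtain ⟨l, h, h'⟩ := exists_line_through p p'
    have h1 := C.valid (show (leviGraph F).Adj (Sum.inl p) (Sum.inr l) from h)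
    have h2 := C.valid (show (leviGraph F).Adj (Sum.inl p') (Sum.inr l) from h')
    -- Among fewer than three colors, two that differ from a third are equal.
    omega
  have hll : ∀ l l' : SubspaceOfDim F 2, C (Sum.inr l) = C (Sum.inr l') := fun l l' => by
    obtain ⟨p, h, h'⟩ := exists_common_point l l'
    have h1 := C.valid (show (leviGraph F).Adj (Sum.inl p) (Sum.inr l) from h)
    have h2 := C.valid (show (leviGraph F).Adj (Sum.inl p) (Sum.inr l') from h')
    omega
  let e : (Fin 3 → F) ≃ₗ[F] (Fin 3 → F) := LinearEquiv.funCongrLeft F F (Equiv.swap 0 1)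
  have hcol : ∀ x, C (autOfLinearEquiv e x) = C x := by
    rintro (p | l)
    · exact hpp _ _
    · exact hll _ _
  have hid := hC (autOfLinearEquiv e) fun c => by
    ext x
    constructor
    · rintro ⟨y, hy, rfl⟩
      exact (hcol y).trans hy
    · intro hx
      refine ⟨(autOfLinearEquiv e).symm x, ?_, by simp⟩
      have := hcol ((autOfLinearEquiv e).symm x)
      rw [RelIso.apply_symm_apply] at this
      exact this.symm.trans hx
  have hv : (![1, 0, 0] : Fin 3 → F) ≠ 0 := fun h => by simpa using congrFun h 0
  have h := DFunLike.congr_fun hid (Sum.inl (point _ hv))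
  have h' : Submodule.map (e : (Fin 3 → F) →ₗ[F] (Fin 3 → F)) (F ∙ ![1, 0, 0]) =
      F ∙ ![1, 0, 0] := congrArg Subtype.val (Sum.inl.inj h)
  have hm : e ![1, 0, 0] ∈ F ∙ (![1, 0, 0] : Fin 3 → F) := by
    rw [← h']
    exact Submodule.mem_map_of_mem (Submodule.mem_span_singleton_self _)
  obtain ⟨a, ha⟩ := Submodule.mem_span_singleton.1 hm
  simpa [e, LinearMap.funLeft] using congrFun ha 1

/-! ### Affine coordinates -/

/-- The affine point `(x, y)`. -/
def affinePoint (x y : F) : SubspaceOfDim F 1 :=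
  point ![x, y, 1] fun h => by simpa using congrFun h 2

/-- The line at infinity. -/
def lineAtInfinity (F : Type*) [Field F] : SubspaceOfDim F 2 :=
  line ![0, 0, 1] fun h => by simpa using congrFun h 2

/-- The line `x = c`. -/
def verticalLine (c : F) : SubspaceOfDim F 2 :=
  line ![1, 0, -c] fun h => by simpa using congrFun h 0

/-- The line `y = m * x + k`. -/
def graphLine (m k : F) : SubspaceOfDim F 2 :=
  line ![-m, 1, -k] fun h => by simpa using congrFun h 1

@[simp]
theorem affinePoint_le_verticalLine {x y c : F} :
    (affinePoint x y).1 ≤ (verticalLine c).1 ↔ x = c := by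
  simp [affinePoint, verticalLine, point_le_line_iff, ← sub_eq_add_neg, sub_eq_zero]

@[simp]
theorem affinePoint_le_graphLine {x y m k : F} :
    (affinePoint x y).1 ≤ (graphLine m k).1 ↔ y = m * x + k := by
  simp only [affinePoint, graphLine, point_le_line_iff, Matrix.vec3_dotProduct', mul_one,
    one_mul]
  constructor <;> intro h <;> linear_combination h

@[simp]
theorem not_affinePoint_le_lineAtInfinity {x y : F} :
    ¬ (affinePoint x y).1 ≤ (lineAtInfinity F).1 := by
  simp [affinePoint, lineAtInfinity, point_le_line_iff]

theorem exists_eq_affinePoint {p : SubspaceOfDim F 1} (hp : ¬ p.1 ≤ (lineAtInfinity F).1) :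
    ∃ x y, p = affinePoint x y := by
  obtain ⟨v, hv, rfl⟩ := exists_eq_point p
  have h2 : v 2 ≠ 0 := by simpa [lineAtInfinity, point_le_line_iff, dotProduct, Fin.sum_univ_three] using hp
  refine ⟨v 0 / v 2, v 1 / v 2, Subtype.ext ?_⟩
  have : v = v 2 • ![v 0 / v 2, v 1 / v 2, 1] := by
    ext i; fin_cases i <;> simp [mul_div_cancel₀, h2]
  change F ∙ v = F ∙ ![v 0 / v 2, v 1 / v 2, 1]
  conv_lhs => rw [this]
  exact Submodule.span_singleton_smul_eq (IsUnit.mk0 _ h2) _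

theorem affinePoint_inj {x y x' y' : F} :
    affinePoint x y = affinePoint x' y' ↔ x = x' ∧ y = y' := by
  constructor
  · intro h
    have h1 : (affinePoint x y).1 ≤ (verticalLine x').1 := by simp [h]
    have h2 : (affinePoint x y).1 ≤ (graphLine 0 y').1 := by simp [h]
    exact ⟨by simpa using h1, by simpa using h2⟩
  · rintro ⟨rfl, rfl⟩; rfl

theorem verticalLine_ne_graphLine (c m k : F) : verticalLine c ≠ graphLine m k := fun h => by
  have h1 : (affinePoint c (m * c + k + 1)).1 ≤ (graphLine m k).1 := by simp [← h]
  simp at h1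

theorem verticalLine_ne_lineAtInfinity (c : F) : verticalLine c ≠ lineAtInfinity F := fun h => by
  have h1 : (affinePoint c 0).1 ≤ (lineAtInfinity F).1 := by simp [← h]
  simp at h1

theorem graphLine_ne_lineAtInfinity (m k : F) : graphLine m k ≠ lineAtInfinity F := fun h => by
  have h1 : (affinePoint 0 k).1 ≤ (lineAtInfinity F).1 := by simp [← h]
  simp at h1

/-- Parallel lines meet the line at infinity in the same point. -/
theorem le_graphLine_of_common_point {p : SubspaceOfDim F 1} {m k : F}
    (h : p.1 ≤ (graphLine m k).1) (hinf : p.1 ≤ (lineAtInfinity F).1) (k' : F) :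
    p.1 ≤ (graphLine m k').1 := by
  obtain ⟨v, hv, rfl⟩ := exists_eq_point p
  simp only [graphLine, lineAtInfinity, point_le_line_iff, dotProduct, Fin.sum_univ_three,
    Matrix.cons_val] at *
  linear_combination h + (k - k') * hinf

theorem le_verticalLine_of_common_point {p : SubspaceOfDim F 1} {c : F}
    (h : p.1 ≤ (verticalLine c).1) (hinf : p.1 ≤ (lineAtInfinity F).1) (c' : F) :
    p.1 ≤ (verticalLine c').1 := by
  obtain ⟨v, hv, rfl⟩ := exists_eq_point p
  simp only [verticalLine, lineAtInfinity, point_le_line_iff, dotProduct, Fin.sum_univ_three,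
    Matrix.cons_val] at *
  linear_combination h + (c - c') * hinf

theorem line_cases (l : SubspaceOfDim F 2) :
    l = lineAtInfinity F ∨ (∃ c, l = verticalLine c) ∨ ∃ m k, l = graphLine m k := by
  obtain ⟨w, hw, rfl⟩ := exists_eq_line l
  have smul_eq : ∀ (a : F) (w' : Fin 3 → F) (hw' : w' ≠ 0), a ≠ 0 → w = a • w' →
      line w hw = line w' hw' := by
    rintro a w' hw' ha rfl
    refine Subtype.ext ?_
    ext x
    simp [line, ha]
  by_cases h1 : w 1 = 0
  · by_cases h0 : w 0 = 0
    · left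
      have h2 : w 2 ≠ 0 := fun h2 => hw (by ext i; fin_cases i <;> assumption)
      exact smul_eq (w 2) _ _ h2 (by ext i; fin_cases i <;> simp [h0, h1])
    · right; left
      refine ⟨-(w 2 / w 0), smul_eq (w 0) _ _ h0 ?_⟩
      ext i; fin_cases i <;> simp [h1, mul_div_cancel₀, h0]
  · right; right
    refine ⟨-(w 0 / w 1), -(w 2 / w 1), smul_eq (w 1) _ _ h1 ?_⟩
    ext i; fin_cases i <;> simp [mul_div_cancel₀, h1]

end LeviGraph

namespace LeviGraph

variable {F : Type*} [Field F]

/-! ### The coloring with three colors -/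

/-- The points `(x, 0)`, the points `(0, y)` with `y ≠ g`, and the point `(1, 1)`. -/
def specialPoints (g : F) : Set (SubspaceOfDim F 1) :=
  {p | ∃ x y, p = affinePoint x y ∧ (y = 0 ∨ (x = 0 ∧ y ≠ g) ∨ (x = 1 ∧ y = 1))}

theorem affinePoint_mem_specialPoints {g x y : F} :
    affinePoint x y ∈ specialPoints g ↔ y = 0 ∨ (x = 0 ∧ y ≠ g) ∨ (x = 1 ∧ y = 1) := by
  constructor
  · rintro ⟨x', y', h, h'⟩
    obtain ⟨rfl, rfl⟩ := affinePoint_inj.1 h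
    exact h'
  · exact fun h => ⟨x, y, rfl, h⟩

theorem not_le_lineAtInfinity_of_mem_specialPoints {g : F} {p : SubspaceOfDim F 1}
    (hp : p ∈ specialPoints g) : ¬ p.1 ≤ (lineAtInfinity F).1 := by
  obtain ⟨x, y, rfl, -⟩ := hp
  simp

open Classical in
/-- The special points and the line at infinity have color `2`, the other points color `0`, and the
other lines color `1`. -/
noncomputable def threeColoring (g : F) : (leviGraph F).Coloring (Fin 3) :=
  SimpleGraph.Coloring.mk
    (Sum.elim (fun p => if p ∈ specialPoints g then 2 else 0)
      (fun l => if l = lineAtInfinity F then 2 else 1)) (by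
    have key : ∀ (p : SubspaceOfDim F 1) (l : SubspaceOfDim F 2), p.1 ≤ l.1 →
        (if p ∈ specialPoints g then (2 : Fin 3) else 0) ≠
          if l = lineAtInfinity F then 2 else 1 := by
      intro p l h
      by_cases hp : p ∈ specialPoints g
      · have hl : l ≠ lineAtInfinity F := by
          rintro rfl
          exact not_le_lineAtInfinity_of_mem_specialPoints hp h
        simp [hp, hl]
      · by_cases hl : l = lineAtInfinity F <;> simp [hp, hl]
    rintro (p | l) (p' | l') h
    · exact h.elim
    · exact key _ _ h
    · exact (key _ _ h).symm
    · exact h.elim)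

theorem threeColoring_inl_eq_two {g : F} {p : SubspaceOfDim F 1} :
    threeColoring g (Sum.inl p) = 2 ↔ p ∈ specialPoints g := by
  classical
  change (if p ∈ specialPoints g then (2 : Fin 3) else 0) = 2 ↔ _
  split_ifs with h <;> simp [h]

theorem threeColoring_inl_ne_one {g : F} {p : SubspaceOfDim F 1} :
    threeColoring g (Sum.inl p) ≠ 1 := by
  classical
  change (if p ∈ specialPoints g then (2 : Fin 3) else 0) ≠ 1
  split_ifs <;> simp

theorem threeColoring_inr_eq_one {g : F} {l : SubspaceOfDim F 2} :
    threeColoring g (Sum.inr l) = 1 ↔ l ≠ lineAtInfinity F := by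
  classical
  change (if l = lineAtInfinity F then (2 : Fin 3) else 1) = 1 ↔ _
  split_ifs with h <;> simp [h]

/-! ### Color-preserving automorphisms do not exchange points and lines -/

section Sides

variable {g : F} {φ : leviGraph F ≃g leviGraph F}
  (hφ : ∀ x, threeColoring g (φ x) = threeColoring g x)

include hφ

theorem exists_map_inl_eq (p : SubspaceOfDim F 1) : ∃ p', φ (Sum.inl p) = Sum.inl p' := by
  -- A line through the origin is not at infinity, so it has color `1`, which no point has.
  obtain ⟨l, hp, hl⟩ := exists_line_through p (affinePoint 0 0)
  have hl' : l ≠ lineAtInfinity F := by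
    rintro rfl
    simp at hl
  have hadj := φ.map_rel_iff.2 (show (leviGraph F).Adj (Sum.inl p) (Sum.inr l) from hp)
  have hcol := (hφ (Sum.inr l)).trans (threeColoring_inr_eq_one.2 hl')
  rcases h1 : φ (Sum.inr l) with q | m
  · rw [h1] at hcol
    exact (threeColoring_inl_ne_one hcol).elim
  · rcases h2 : φ (Sum.inl p) with p' | m'
    · exact ⟨p', rfl⟩
    · rw [h1, h2] at hadj
      exact hadj.elim

theorem exists_map_inr_eq (l : SubspaceOfDim F 2) : ∃ l', φ (Sum.inr l) = Sum.inr l' := by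
  obtain ⟨p, hp, -⟩ := exists_common_point l l
  obtain ⟨p', hp'⟩ := exists_map_inl_eq hφ p
  have hadj := φ.map_rel_iff.2 (show (leviGraph F).Adj (Sum.inl p) (Sum.inr l) from hp)
  rcases h : φ (Sum.inr l) with q | m
  · rw [hp', h] at hadj
    exact hadj.elim
  · exact ⟨m, rfl⟩

end Sides

/-! ### Collineations preserving the special points -/

section Collineation

variable {f : SubspaceOfDim F 1 ≃ SubspaceOfDim F 1} {h : SubspaceOfDim F 2 ≃ SubspaceOfDim F 2}
  (hfh : ∀ p l, (f p).1 ≤ (h l).1 ↔ p.1 ≤ l.1)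

include hfh

theorem map_line_eq_of_fixed {p p' : SubspaceOfDim F 1} {l : SubspaceOfDim F 2} (hp : f p = p)
    (hp' : f p' = p') (hne : p ≠ p') (hl : p.1 ≤ l.1) (hl' : p'.1 ≤ l.1) : h l = l := by
  have h1 := (hfh p l).2 hl
  have h2 := (hfh p' l).2 hl'
  rw [hp] at h1
  rw [hp'] at h2
  exact (eq_of_incident h1 hl h2 hl').resolve_left hne

theorem map_point_eq_of_fixed {p : SubspaceOfDim F 1} {l l' : SubspaceOfDim F 2} (hl : h l = l)
    (hl' : h l' = l') (hne : l ≠ l') (hp : p.1 ≤ l.1) (hp' : p.1 ≤ l'.1) : f p = p := by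
  have h1 := (hfh p l).2 hp
  have h2 := (hfh p l').2 hp'
  rw [hl] at h1
  rw [hl'] at h2
  exact (eq_of_incident h1 h2 hp hp').resolve_right hne

theorem collineation_eq_refl (hinf : h (lineAtInfinity F) = lineAtInfinity F)
    (hfix : ∀ x y, f (affinePoint x y) = affinePoint x y) : (∀ p, f p = p) ∧ ∀ l, h l = l := by
  have hlines : ∀ l, h l = l := by
    intro l
    obtain rfl | ⟨c, rfl⟩ | ⟨m, k, rfl⟩ := line_cases l
    · exact hinf
    · exact map_line_eq_of_fixed hfh (hfix c 0) (hfix c 1) (by simp [affinePoint_inj])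
        (by simp) (by simp)
    · exact map_line_eq_of_fixed hfh (hfix 0 k) (hfix 1 (m + k)) (by simp [affinePoint_inj])
        (by simp) (by simp)
  refine ⟨fun p => ?_, hlines⟩
  obtain ⟨l, h1, h1'⟩ := exists_line_through p (affinePoint 0 0)
  by_cases hp : p.1 ≤ (lineAtInfinity F).1
  · refine map_point_eq_of_fixed hfh (hlines l) (hlines (lineAtInfinity F)) ?_ h1 hp
    rintro rfl
    simp at h1'
  · obtain ⟨x, y, rfl⟩ := exists_eq_affinePoint hp
    exact hfix x y

/-- The points at infinity of the axes are fixed, so horizontals and verticals through fixed points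
are fixed. The diagonal turns the line `y = a` into `x = a`, and the line `y = g * x` turns `x = a`
into `y = g * a`; iteration from `y = 1` reaches every nonzero height. -/
theorem affinePoint_fixed_of_frame {g : F} (hg : ∀ a : F, a ≠ 0 → ∃ n : ℕ, g ^ n = a)
    (hinf : h (lineAtInfinity F) = lineAtInfinity F) (hx : h (graphLine 0 0) = graphLine 0 0)
    (hy : h (verticalLine 0) = verticalLine 0) (hQ : f (affinePoint 1 1) = affinePoint 1 1)
    (hG : f (affinePoint 0 g) = affinePoint 0 g) (x y : F) :
    f (affinePoint x y) = affinePoint x y := by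
  obtain ⟨U, hUx, hUinf⟩ := exists_common_point (graphLine 0 0) (lineAtInfinity F)
  obtain ⟨V, hVy, hVinf⟩ := exists_common_point (verticalLine 0) (lineAtInfinity F)
  have hU := map_point_eq_of_fixed hfh hx hinf (graphLine_ne_lineAtInfinity _ _) hUx hUinf
  have hV := map_point_eq_of_fixed hfh hy hinf (verticalLine_ne_lineAtInfinity _) hVy hVinf
  have hUgraph : ∀ k : F, U.1 ≤ (graphLine 0 k).1 := le_graphLine_of_common_point hUx hUinf
  have hVvert : ∀ c : F, V.1 ≤ (verticalLine c).1 := le_verticalLine_of_common_point hVy hVinf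
  have hUne : ∀ x y, affinePoint x y ≠ U := fun x y e => by
    rw [← e] at hUinf
    simp at hUinf
  have hVne : ∀ x y, affinePoint x y ≠ V := fun x y e => by
    rw [← e] at hVinf
    simp at hVinf
  have horiz : ∀ x y, f (affinePoint x y) = affinePoint x y → h (graphLine 0 y) = graphLine 0 y :=
    fun x y e => map_line_eq_of_fixed hfh e hU (hUne x y) (by simp) (hUgraph y)
  have vert : ∀ x y, f (affinePoint x y) = affinePoint x y → h (verticalLine x) = verticalLine x :=
    fun x y e => map_line_eq_of_fixed hfh e hV (hVne x y) (by simp) (hVvert x)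
  have hO : f (affinePoint 0 0) = affinePoint 0 0 :=
    map_point_eq_of_fixed hfh hy hx (verticalLine_ne_graphLine _ _ _) (by simp) (by simp)
  have hdiag : h (graphLine 1 0) = graphLine 1 0 :=
    map_line_eq_of_fixed hfh hO hQ (by simp [affinePoint_inj]) (by simp) (by simp)
  have h1g : f (affinePoint 1 g) = affinePoint 1 g :=
    map_point_eq_of_fixed hfh (vert 1 1 hQ) (horiz 0 g hG) (verticalLine_ne_graphLine _ _ _)
      (by simp) (by simp)
  have hslope : h (graphLine g 0) = graphLine g 0 :=
    map_line_eq_of_fixed hfh hO h1g (by simp [affinePoint_inj]) (by simp) (by simp)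
  have grid : ∀ a b, h (verticalLine a) = verticalLine a → h (graphLine 0 b) = graphLine 0 b →
      f (affinePoint a b) = affinePoint a b := fun a b ha hb =>
    map_point_eq_of_fixed hfh ha hb (verticalLine_ne_graphLine _ _ _) (by simp) (by simp)
  have vert_of_horiz : ∀ a, h (graphLine 0 a) = graphLine 0 a →
      h (verticalLine a) = verticalLine a := fun a ha => by
    by_cases ha0 : a = 0
    · rw [ha0, hy]
    refine vert a a (map_point_eq_of_fixed hfh hdiag ha (fun e => ?_) (by simp) (by simp))
    have : (affinePoint 0 0 : SubspaceOfDim F 1).1 ≤ (graphLine 0 a).1 := by simp [← e]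
    rw [affinePoint_le_graphLine] at this
    exact ha0 (by simpa using this.symm)
  have hpow : ∀ n : ℕ, h (graphLine 0 (g ^ n)) = graphLine 0 (g ^ n) := fun n => by
    induction n with
    | zero => simpa using horiz 1 1 hQ
    | succ n ih =>
      refine horiz (g ^ n) _ (map_point_eq_of_fixed hfh (vert_of_horiz _ ih) hslope
        (verticalLine_ne_graphLine _ _ _) (by simp) ?_)
      simp [pow_succ']
  have hall : ∀ a, h (graphLine 0 a) = graphLine 0 a := fun a => by
    by_cases ha : a = 0
    · rw [ha, hx]
    · obtain ⟨n, rfl⟩ := hg a ha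
      exact hpow n
  exact grid x y (vert_of_horiz x (hall x)) (hall y)

/-- The x-axis is the only affine line all of whose affine points are special, and any line other
than the axes has at least two non-special affine points, whereas the y-axis has exactly one. -/
theorem affinePoint_fixed [Finite F] (hF : 5 ≤ Nat.card F) {g : F} (hg1 : g ≠ 1)
    (hg : ∀ a : F, a ≠ 0 → ∃ n : ℕ, g ^ n = a)
    (hinf : h (lineAtInfinity F) = lineAtInfinity F)
    (hS : ∀ p, f p ∈ specialPoints g ↔ p ∈ specialPoints g) (x y : F) :
    f (affinePoint x y) = affinePoint x y := by
  classical
  have := Fintype.ofFinite F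
  rw [Nat.card_eq_fintype_card] at hF
  -- The powers of `0` are only `0` and `1`.
  have hg0 : g ≠ 0 := by
    rintro rfl
    have : ∃ a : F, a ∉ ({0, 1} : Finset F) :=
      Finset.exists_mem_notMem_of_card_lt_card (t := Finset.univ) (s := {0, 1})
        ((Finset.card_le_two).trans_lt (by rw [Finset.card_univ]; omega)) |>.imp fun a h => h.2
    obtain ⟨a, ha⟩ := this
    simp only [Finset.mem_insert, Finset.mem_singleton, not_or] at ha
    obtain ⟨n, rfl⟩ := hg a ha.1
    rcases n with _ | n <;> simp at ha
  -- This is where five elements are needed: two must remain after three are excluded.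
  have exists_pair : ∀ a b c : F, ∃ x y, x ≠ y ∧ (x ≠ a ∧ x ≠ b ∧ x ≠ c) ∧
      (y ≠ a ∧ y ≠ b ∧ y ≠ c) := fun a b c => by
    have h3 : ({a, b, c} : Finset F).card ≤ 3 := Finset.card_le_three
    have : 1 < ({a, b, c} : Finset F)ᶜ.card := by
      rw [Finset.card_compl]; omega
    obtain ⟨x, hx, y, hy, hxy⟩ := Finset.one_lt_card.1 this
    exact ⟨x, y, hxy, by simpa using hx, by simpa using hy⟩
  have hinfp : ∀ p, (f p).1 ≤ (lineAtInfinity F).1 ↔ p.1 ≤ (lineAtInfinity F).1 := fun p => by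
    conv_lhs => rw [← hinf]
    exact hfh _ _
  have hinfl : ∀ l, l ≠ lineAtInfinity F → h l ≠ lineAtInfinity F := fun l hl e =>
    hl (h.injective (e.trans hinf.symm))
  have hx : h (graphLine 0 0) = graphLine 0 0 := by
    have full : ∀ x y, (affinePoint x y).1 ≤ (h (graphLine 0 0)).1 →
        affinePoint x y ∈ specialPoints g := fun x y hxy => by
      obtain ⟨p, hp⟩ := f.surjective (affinePoint x y)
      rw [← hp] at hxy ⊢
      rw [hS]
      have hp' : ¬ p.1 ≤ (lineAtInfinity F).1 := by
        rw [← hinfp, hp]; simp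
      obtain ⟨x', y', rfl⟩ := exists_eq_affinePoint hp'
      rw [hfh] at hxy
      rw [affinePoint_mem_specialPoints]
      left
      simpa using hxy
    obtain e | ⟨c, e⟩ | ⟨m, k, e⟩ := line_cases (h (graphLine 0 0))
    · exact (hinfl _ (graphLine_ne_lineAtInfinity _ _) e).elim
    · exfalso
      rw [e] at full
      by_cases hc : c = 0
      · have := full c g (by simp)
        simp [affinePoint_mem_specialPoints, hg0, hg1] at this
      · obtain ⟨y, -, -, ⟨hy0, hy1, -⟩, -⟩ := exists_pair 0 1 1
        have := full c y (by simp)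
        simp [affinePoint_mem_specialPoints, hy0, hy1, hc] at this
    · rw [e] at full ⊢
      by_contra hne
      -- `-k / m` is where the line crosses the x-axis; the case `m = 0` is treated separately, so
      -- the default value of the division is harmless.
      obtain ⟨x, -, -, ⟨hx0, hx1, hx2⟩, -⟩ := exists_pair 0 1 (-k / m)
      have := full x (m * x + k) (by simp)
      simp only [affinePoint_mem_specialPoints, hx0, hx1, false_and, or_false] at this
      by_cases hm : m = 0
      · subst hm
        simp only [zero_mul, zero_add] at this
        exact hne (by rw [this])
      · apply hx2
        field_simp
        linear_combination this
  have hy : h (verticalLine 0) = verticalLine 0 := by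
    -- A non-special affine point on the image of the y-axis can only be the image of `(0, g)`.
    have almost : ∀ x y x' y', (affinePoint x y).1 ≤ (h (verticalLine 0)).1 →
        (affinePoint x' y').1 ≤ (h (verticalLine 0)).1 →
        affinePoint x y ∉ specialPoints g → affinePoint x' y' ∉ specialPoints g →
        x = x' ∧ y = y' := by
      have key : ∀ x y, (affinePoint x y).1 ≤ (h (verticalLine 0)).1 →
          affinePoint x y ∉ specialPoints g → affinePoint x y = f (affinePoint 0 g) := by
        intro x y hxy hs
        obtain ⟨p, hp⟩ := f.surjective (affinePoint x y)
        rw [← hp] at hxy hs ⊢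
        rw [hS] at hs
        have hp' : ¬ p.1 ≤ (lineAtInfinity F).1 := by
          rw [← hinfp, hp]; simp
        obtain ⟨x', y', rfl⟩ := exists_eq_affinePoint hp'
        rw [hfh, affinePoint_le_verticalLine] at hxy
        subst hxy
        simp only [affinePoint_mem_specialPoints, true_and, not_or, not_not] at hs
        rw [hs.2.1]
      intro x y x' y' h1 h2 h3 h4
      exact affinePoint_inj.1 ((key x y h1 h3).trans (key x' y' h2 h4).symm)
    obtain e | ⟨c, e⟩ | ⟨m, k, e⟩ := line_cases (h (verticalLine 0))
    · exact (hinfl _ (verticalLine_ne_lineAtInfinity _) e).elim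
    · rw [e] at almost ⊢
      by_contra hne
      have hc : c ≠ 0 := by rintro rfl; exact hne rfl
      obtain ⟨y, y', hyy, ⟨hy0, hy1, -⟩, ⟨hy0', hy1', -⟩⟩ := exists_pair 0 1 1
      refine hyy (almost c y c y' (by simp) (by simp) ?_ ?_).2 <;>
      simp [affinePoint_mem_specialPoints, *]
    · exfalso
      have hne : graphLine m k ≠ graphLine 0 0 := fun e' =>
        verticalLine_ne_graphLine 0 0 0 (h.injective (e.trans (e'.trans hx.symm)))
      rw [e] at almost
      have key : ∀ x, x ≠ 0 → x ≠ 1 → x ≠ -k / m →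
          affinePoint x (m * x + k) ∉ specialPoints g := by
        intro x hx0 hx1 hx2 this
        simp only [affinePoint_mem_specialPoints, hx0, hx1, false_and, or_false] at this
        by_cases hm : m = 0
        · subst hm
          simp only [zero_mul, zero_add] at this
          exact hne (by rw [this])
        · apply hx2
          field_simp
          linear_combination this
      obtain ⟨x, x', hxx, ⟨hx0, hx1, hx2⟩, ⟨hx0', hx1', hx2'⟩⟩ := exists_pair 0 1 (-k / m)
      exact hxx (almost _ _ _ _ (by simp) (by simp) (key x hx0 hx1 hx2)
        (key x' hx0' hx1' hx2')).1
  have hfx : ∀ p, (f p).1 ≤ (graphLine 0 0 : SubspaceOfDim F 2).1 ↔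
      p.1 ≤ (graphLine 0 0 : SubspaceOfDim F 2).1 := fun p => by
    conv_lhs => rw [← hx]
    exact hfh _ _
  have hfy : ∀ p, (f p).1 ≤ (verticalLine 0 : SubspaceOfDim F 2).1 ↔
      p.1 ≤ (verticalLine 0 : SubspaceOfDim F 2).1 := fun p => by
    conv_lhs => rw [← hy]
    exact hfh _ _
  refine affinePoint_fixed_of_frame hfh hg hinf hx hy ?_ ?_ x y
  -- `(1, 1)` is the only special point off both axes.
  · obtain ⟨a, b, e⟩ := exists_eq_affinePoint ((hinfp (affinePoint 1 1)).not.2 (by simp))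
    have h1 := (hfx (affinePoint 1 1)).not.2 (by simp)
    have h2 := (hfy (affinePoint 1 1)).not.2 (by simp)
    have h3 := (hS (affinePoint 1 1)).2 (by simp [affinePoint_mem_specialPoints])
    rw [e] at h1 h2 h3 ⊢
    simp only [affinePoint_le_graphLine, affinePoint_le_verticalLine, zero_mul, zero_add] at h1 h2
    simp only [affinePoint_mem_specialPoints, h1, h2, false_and, false_or] at h3
    exact affinePoint_inj.2 h3
  · obtain ⟨a, b, e⟩ := exists_eq_affinePoint ((hinfp (affinePoint 0 g)).not.2 (by simp))
    have h2 := (hfy (affinePoint 0 g)).2 (by simp)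
    have h3 := (hS (affinePoint 0 g)).not.2 (by simp [affinePoint_mem_specialPoints, hg0])
    rw [e] at h2 h3 ⊢
    rw [affinePoint_le_verticalLine] at h2
    simp only [affinePoint_mem_specialPoints, h2, true_and, not_or, not_not] at h3
    exact affinePoint_inj.2 ⟨h2, h3.2.1⟩

end Collineation

/-! ### From automorphisms to collineations, and the conclusion -/

theorem isDistinguishing_threeColoring [Finite F] (hF : 5 ≤ Nat.card F) {g : F} (hg1 : g ≠ 1)
    (hg : ∀ a : F, a ≠ 0 → ∃ n : ℕ, g ^ n = a) : IsDistinguishing (threeColoring g) := by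
  intro φ hcl
  have hφ : ∀ x, threeColoring g (φ x) = threeColoring g x := fun x => by
    have hx : φ x ∈ φ '' (threeColoring g).colorClass (threeColoring g x) := ⟨x, rfl, rfl⟩
    rw [hcl] at hx
    exact hx
  -- The inverse automorphism also preserves colors; it supplies the inverses of the maps on points
  -- and on lines.
  have hφ' : ∀ x, threeColoring g (φ.symm x) = threeColoring g x := fun x => by
    rw [← hφ (φ.symm x), RelIso.apply_symm_apply]
  choose f hf using exists_map_inl_eq hφ
  choose f' hf' using exists_map_inl_eq hφ'
  choose h hh using exists_map_inr_eq hφ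
  choose h' hh' using exists_map_inr_eq hφ'
  let fe : SubspaceOfDim F 1 ≃ SubspaceOfDim F 1 :=
    ⟨f, f', fun p => Sum.inl_injective (by rw [← hf', ← hf, RelIso.symm_apply_apply]),
      fun p => Sum.inl_injective (by rw [← hf, ← hf', RelIso.apply_symm_apply])⟩
  let he : SubspaceOfDim F 2 ≃ SubspaceOfDim F 2 :=
    ⟨h, h', fun p => Sum.inr_injective (by rw [← hh', ← hh, RelIso.symm_apply_apply]),
      fun p => Sum.inr_injective (by rw [← hh, ← hh', RelIso.apply_symm_apply])⟩
  have hfh : ∀ p l, (fe p).1 ≤ (he l).1 ↔ p.1 ≤ l.1 := fun p l => by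
    have := φ.map_rel_iff (a := Sum.inl p) (b := Sum.inr l)
    rw [hf, hh] at this
    exact this
  have hinf : he (lineAtInfinity F) = lineAtInfinity F := by
    by_contra hne
    have h1 := threeColoring_inr_eq_one (g := g).2 hne
    change threeColoring g (Sum.inr (h _)) = 1 at h1
    rw [← hh, hφ] at h1
    exact threeColoring_inr_eq_one.1 h1 rfl
  have hS : ∀ p, fe p ∈ specialPoints g ↔ p ∈ specialPoints g := fun p => by
    rw [← threeColoring_inl_eq_two, ← threeColoring_inl_eq_two, ← hφ (Sum.inl p), hf]
    rfl
  obtain ⟨h1, h2⟩ := collineation_eq_refl hfh hinf (affinePoint_fixed hfh hF hg1 hg hinf hS)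
  ext x
  rcases x with p | l
  · exact (hf p).trans (congrArg Sum.inl (h1 p))
  · exact (hh l).trans (congrArg Sum.inr (h2 l))

end LeviGraph

theorem mainTheorem2 (q : ℕ) (hq : IsPrimePow q) (hq5 : 5 ≤ q)
    (F : Type*) [Field F] (hF : Nat.card F = q) :
    distinguishingChromaticNumber (leviGraph F) = 3 := by
  have : Finite F := Nat.finite_of_card_ne_zero (by omega)
  have := Fintype.ofFinite F
  obtain ⟨u, hu⟩ := IsCyclic.exists_generator (α := Fˣ)
  have hgen : ∀ a : F, a ≠ 0 → ∃ n : ℕ, (u : F) ^ n = a := fun a ha => by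
    -- In a finite group natural powers already exhaust the integer powers, as the induction on
    -- exponents requires.
    obtain ⟨n, hn⟩ := (mem_powers_iff_mem_zpowers (x := u)).2 (hu (Units.mk0 a ha))
    exact ⟨n, by simpa using congrArg Units.val hn⟩
  have hu1 : (u : F) ≠ 1 := fun h1 => by
    have hle : Nat.card F ≤ 2 := by
      classical
      rw [Nat.card_eq_fintype_card, ← Finset.card_univ]
      refine (Finset.card_le_card (t := {0, 1}) fun a _ => ?_).trans Finset.card_le_two
      by_cases ha : a = 0
      · simp [ha]
      · obtain ⟨n, rfl⟩ := hgen a ha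
        simp [h1]
    omega
  refine le_antisymm ?_ ?_
  · exact iInf₂_le (3 : ℕ)
      ⟨_, LeviGraph.isDistinguishing_threeColoring (by omega) hu1 hgen⟩
  · refine le_iInf₂ fun n hn => ?_
    obtain ⟨C, hC⟩ := hn
    by_contra hlt
    refine LeviGraph.not_isDistinguishing_of_lt_three ?_ C hC
    exact_mod_cast not_le.1 hlt
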